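/- **Theorem 1.** Let $X=(X_{C_1},\dots,X_{C_k})\in\mathbb R^{n\times p}$ be a fixed design matrix whose columns are partitioned into $k$ non-empty groups of sizes $c_i=|C_i|$, and let $y=X\beta+\epsilon$ with $\beta\in\mathbb R^p$ and $\epsilon\sim N(0,\sigma^2 I_n)$, $\sigma\ge 0$. (Neither normalization nor full rank of $X$ is needed.) *PCA prototypes.* For each $i$ let $X_{C_i}=U_{C_i}D_iV_i^T$ be a singular value decomposition, where $U_{C_i}\in\mathbb R^{n\times c_i}$ has orthonormal columns, $V_i\in\mathbb R^{c_i\times c_i}$ is orthogonal, and $D_i$ is diagonal with nonnegative entries in decreasing order. Let $U_{C_i,1}$ be the first column of $U_{C_i}$ (the first principal component), $U_P=(U_{C_1,1},\dots,U_{C_k,1})$, let $U_Q$ consist of the remaining columns of all the $U_{C_i}$, and put $U=[U_P,U_Q]$. *Localized knockoffs.* Let $\tilde U_P\in\mathbb R^{n\times k}$ and $s_P\in\mathbb R^k$ be such that $\tilde U=[\tilde U_P,U_Q]$ satisfies $$\tilde U^T\tilde U=U^TU,\qquad U^TU-\tilde U^TU=\mathrm{diag}(s_P,0).$$ *Statistics.*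 Fix $m\ge 0$. A knockoff statistic is a rule $w$ that assigns a vector $w(Z,N,y)\in\mathbb R^k$ to $Z=[A,\tilde A]\in\mathbb R^{n\times 2k}$, to $N\in\mathbb R^{n\times m}$ with orthonormal columns and $N^TZ=0$, and to $y\in\mathbb R^n$, is measurable in $y$, depends only on $Z^TZ$ and $[Z\ N]^Ty$, and is antisymmetric: for every $S\subseteq\{1,\dots,k\}$, interchanging the $j$-th columns of $A$ and $\tilde A$ for all $j\in S$ changes the sign of $w_j$ for $j\in S$ and leaves $w_j$ unchanged for $j\notin S$. (For $m=0$ it depends only on $Z^TZ$ and $Z^Ty$.) Let $W=w([U_P,\tilde U_P],N,y)$ for such a statistic and any such $N$. *Selection.* For $q\in[0,1]$ let $$T=\min\Big\{t\in\{|W_1|,\dots,|W_k|\}\setminus\{0\}:\ \frac{a+\#\{j:W_j\le -t\}}{\#\{j:W_j\ge t\}\vee 1}\le q\Big\},\qquad \hat S=\{j:W_j\ge T\},$$ with $T=\infty$ if there is no such $t$, where $a=0$ for the knockoff filter and $a=1$ for the knockoff+ filter. Then for every $q\in[0,1]$ the knockoff filter controls the group mFDR and the knockoff+ filter controls the group FDR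 at level $q$: $$E\left[\frac{\#\{i:\beta_{C_i}=0,\ i\in\hat S\}}{\#\hat S+q^{-1}}\right]\le q\quad (a=0),\qquad E\left[\frac{\#\{i:\beta_{C_i}=0,\ i\in\hat S\}}{\#\hat S\vee 1}\right]\le q\quad (a=1),$$ where $q^{-1}=\infty$ (and so the first quotient is $0$) for $q=0$. -/

import Mathlib

open MeasureTheory ProbabilityTheory
open scoped ENNReal NNReal Matrix

noncomputable section

namespace PCAKnockoff

/-! ### Groups, singular value decompositions and prototypes

The `p` columns of a design matrix that is partitioned into `k` groups of sizes `c 0, …, c (k-1)`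
are indexed by `(i : Fin k) × Fin (c i)`. -/

/-- The block of columns of `X` that belongs to the group `i`. -/
def groupBlock {n k : ℕ} {c : Fin k → ℕ} (X : Matrix (Fin n) ((i : Fin k) × Fin (c i)) ℝ)
    (i : Fin k) : Matrix (Fin n) (Fin (c i)) ℝ :=
  fun r a => X r ⟨i, a⟩

/-- `A = U D Vᵀ` is a (thin) singular value decomposition: `U` has orthonormal columns, `V` is
orthogonal and `D = diag d` with nonnegative singular values in decreasing order. -/
structure IsSVD {n c : ℕ} (A U : Matrix (Fin n) (Fin c) ℝ) (d : Fin c → ℝ)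
    (V : Matrix (Fin c) (Fin c) ℝ) : Prop where
  orthonormal_left : Uᵀ * U = 1
  orthogonal_right : V ∈ Matrix.orthogonalGroup (Fin c) ℝ
  nonneg : ∀ a, 0 ≤ d a
  decreasing : Antitone d
  decomposition : A = U * Matrix.diagonal d * Vᵀ

/-- The matrix `(U_{C_1}, …, U_{C_k})` obtained by juxtaposing the blocks. -/
def joinBlocks {n k : ℕ} {c : Fin k → ℕ} (U : (i : Fin k) → Matrix (Fin n) (Fin (c i)) ℝ) :
    Matrix (Fin n) ((i : Fin k) × Fin (c i)) ℝ :=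
  fun r j => U j.1 r j.2

/-- The prototypes `U_P`: the first column of every block. -/
def prototypes {n k : ℕ} {c : Fin k → ℕ} [∀ i, NeZero (c i)]
    (U : (i : Fin k) → Matrix (Fin n) (Fin (c i)) ℝ) : Matrix (Fin n) (Fin k) ℝ :=
  fun r i => U i r 0

/-- The matrix `[Ũ_P, U_Q]`: the prototype columns are replaced by the columns of `UtP`, all the
other columns are kept. -/
def replacePrototypes {n k : ℕ} {c : Fin k → ℕ} [∀ i, NeZero (c i)]
    (U : (i : Fin k) → Matrix (Fin n) (Fin (c i)) ℝ) (UtP : Matrix (Fin n) (Fin k) ℝ) :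
    Matrix (Fin n) ((i : Fin k) × Fin (c i)) ℝ :=
  fun r j => if j.2 = 0 then UtP r j.1 else U j.1 r j.2

/-- `UtP` is a matrix of localized knockoffs of the prototypes, with parameters `s`: for
`U = [U_P, U_Q]` and `Ũ = [Ũ_P, U_Q]` one has `Ũᵀ Ũ = Uᵀ U` and `Uᵀ U - Ũᵀ U = diag(s, 0)`. -/
structure IsLocalizedKnockoff {n k : ℕ} {c : Fin k → ℕ} [∀ i, NeZero (c i)]
    (U : (i : Fin k) → Matrix (Fin n) (Fin (c i)) ℝ) (UtP : Matrix (Fin n) (Fin k) ℝ)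
    (s : Fin k → ℝ) : Prop where
  gram : (replacePrototypes U UtP)ᵀ * replacePrototypes U UtP = (joinBlocks U)ᵀ * joinBlocks U
  cross : (joinBlocks U)ᵀ * joinBlocks U - (replacePrototypes U UtP)ᵀ * joinBlocks U =
    Matrix.diagonal (fun j : (i : Fin k) × Fin (c i) => if j.2 = 0 then s j.1 else 0)

/-! ### Knockoff statistics -/

/-- Interchange the column `j` of the left half of `Z = [A, B]` with the column `j` of the right
half, for every `j ∈ S`. -/
def swapCols {n k : ℕ} (S : Finset (Fin k)) (Z : Matrix (Fin n) (Fin k ⊕ Fin k) ℝ) :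
    Matrix (Fin n) (Fin k ⊕ Fin k) ℝ :=
  fun r j => if j.elim id id ∈ S then Z r j.swap else Z r j

/-- The columns of `N` are orthonormal and orthogonal to the columns of `Z`. -/
structure IsOrthogonalFrame {n k m : ℕ} (Z : Matrix (Fin n) (Fin k ⊕ Fin k) ℝ)
    (N : Matrix (Fin n) (Fin m) ℝ) : Prop where
  orthonormal : Nᵀ * N = 1
  orthogonal : Nᵀ * Z = 0

/-- `w Z N y` is the vector of statistics computed from the augmented design `Z = [A, Ã]`, a
matrix `N` of orthonormal columns orthogonal to `Z`, and the response `y`. It is a knockoff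
statistic if it depends only on the Gram matrix `Zᵀ Z` and on the feature-response products
`[Z N]ᵀ y`, and if interchanging a feature with its knockoff changes the sign of the
corresponding entry and leaves the other entries alone. For `m = 0` the matrix `N` is void. -/
structure IsKnockoffStatistic {n k m : ℕ}
    (w : Matrix (Fin n) (Fin k ⊕ Fin k) ℝ → Matrix (Fin n) (Fin m) ℝ → (Fin n → ℝ) →
      (Fin k → ℝ)) : Prop where
  measurable : ∀ Z N, IsOrthogonalFrame Z N → Measurable (w Z N)
  sufficiency : ∃ f : Matrix (Fin k ⊕ Fin k) (Fin k ⊕ Fin k) ℝ → (Fin k ⊕ Fin k → ℝ) →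
      (Fin m → ℝ) → (Fin k → ℝ),
    ∀ Z N, IsOrthogonalFrame Z N → ∀ y, w Z N y = f (Zᵀ * Z) (Zᵀ *ᵥ y) (Nᵀ *ᵥ y)
  antisymmetry : ∀ Z N, IsOrthogonalFrame Z N → ∀ (S : Finset (Fin k)) (y : Fin n → ℝ) (j : Fin k),
    w (swapCols S Z) N y j = if j ∈ S then - w Z N y j else w Z N y j

/-! ### The knockoff filter and its error rates -/

/-- The data-dependent threshold: the least `t` among the nonzero values of `|W_j|` with
`(a + #{j : W_j ≤ -t}) / max (#{j : W_j ≥ t}) 1 ≤ q`, and `∞` if there is none. The offset is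
`a = 0` for the knockoff filter and `a = 1` for the knockoff+ filter. -/
def threshold {k : ℕ} (a : ℕ) (q : ℝ) (W : Fin k → ℝ) : WithTop ℝ :=
  ((Finset.univ.image fun j => |W j|).filter fun t : ℝ =>
    0 < t ∧
      ((a : ℝ) + ((Finset.univ.filter fun j => W j ≤ -t).card : ℝ)) /
        max ((Finset.univ.filter fun j => t ≤ W j).card : ℝ) 1 ≤ q).min

/-- The selected indices `Ŝ = {j : W_j ≥ T}`. -/
def selected {k : ℕ} (a : ℕ) (q : ℝ) (W : Fin k → ℝ) : Finset (Fin k) :=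
  Finset.univ.filter fun j => threshold a q W ≤ (W j : WithTop ℝ)

/-- The null groups: those whose coefficients in the original model all vanish. -/
def nullGroups {k : ℕ} {c : Fin k → ℕ} (β : (i : Fin k) × Fin (c i) → ℝ) : Finset (Fin k) :=
  Finset.univ.filter fun i => ∀ a, β ⟨i, a⟩ = 0

/-- The group false discovery rate `E[#(Ŝ ∩ H₀) / max (#Ŝ) 1]`. -/
def groupFDR {Ω : Type*} [MeasurableSpace Ω] (P : Measure Ω) {k : ℕ} (H₀ : Finset (Fin k))
    (S : Ω → Finset (Fin k)) : ℝ≥0∞ :=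
  ∫⁻ ω, ((S ω ∩ H₀).card : ℝ≥0∞) / max ((S ω).card : ℝ≥0∞) 1 ∂P

/-- The modified group false discovery rate `E[#(Ŝ ∩ H₀) / (#Ŝ + q⁻¹)]`, with `0⁻¹ = ∞`. -/
def groupMFDR {Ω : Type*} [MeasurableSpace Ω] (P : Measure Ω) {k : ℕ} (H₀ : Finset (Fin k))
    (q : ℝ) (S : Ω → Finset (Fin k)) : ℝ≥0∞ :=
  ∫⁻ ω, ((S ω ∩ H₀).card : ℝ≥0∞) / (((S ω).card : ℝ≥0∞) + (ENNReal.ofReal q)⁻¹) ∂P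

end PCAKnockoff

end

namespace PCAKnockoff

/-! ### Reflections and the Gaussian distribution -/

/-! For a null group `j`, let `u` be the difference between its prototype and the knockoff. The
localized knockoff identities make `u` orthogonal to every block `U i` with `i ≠ j`, and to the
other knockoffs. So the reflection along `u` interchanges the two columns and fixes the remaining
prototypes and knockoffs, `N` and, since `β` vanishes on group `j`, the mean `X β`. It preserves the
Gaussian noise and flips the sign of `W_j` alone (`apply_reflect`); this needs no full rank.

Invariance under these single flips suffices for the error bounds, without a martingale. Let `T_j`
be the threshold after replacing `W_j` by `|W_j|`. A selected null `j` contributes at most `q` times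
the reciprocal of one plus the number of other nulls below `-T_j`. This weight ignores the sign of
`W_j`, so the flip turns the event `W_j ≥ T_j` into `W_j ≤ -T_j` at no cost. All `j` in the latter
events share one threshold, hence their weights sum to at most one (`sum_posPart_flipSign_le_one`).
-/

/-- The reflection of `ℝⁿ` in the hyperplane orthogonal to `u` (the identity if `u = 0`). -/
noncomputable def reflect {n : ℕ} (u x : Fin n → ℝ) : Fin n → ℝ :=
  x - (2 * (u ⬝ᵥ x) / (u ⬝ᵥ u)) • u

lemma reflect_of_dotProduct_eq_zero {n : ℕ} {u x : Fin n → ℝ} (h : u ⬝ᵥ x = 0) :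
    reflect u x = x := by
  simp [reflect, h]

/-- Equal lengths give `|a - b|² = 2 (a - b)·a`, so the coefficient of `a - b` is `1`. The case `a =
b`, where the quotient is `0 / 0`, is separate. -/
lemma reflect_sub_left {n : ℕ} {a b : Fin n → ℝ} (h : a ⬝ᵥ a = b ⬝ᵥ b) :
    reflect (a - b) a = b := by
  have hu : (a - b) ⬝ᵥ (a - b) = 2 * ((a - b) ⬝ᵥ a) := by
    simp only [sub_dotProduct, dotProduct_sub, dotProduct_comm b a]
    linarith
  by_cases h0 : (a - b) ⬝ᵥ (a - b) = 0
  · have hab : a - b = 0 := dotProduct_self_eq_zero.1 h0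
    rw [hab, reflect_of_dotProduct_eq_zero (zero_dotProduct a)]
    exact sub_eq_zero.1 hab
  · rw [reflect, ← hu, div_self h0, one_smul, sub_sub_cancel]

lemma reflect_neg {n : ℕ} (u x : Fin n → ℝ) : reflect (-u) x = reflect u x := by
  simp only [reflect, neg_dotProduct, dotProduct_neg, neg_neg, smul_neg, mul_neg, neg_div, neg_smul]

lemma reflect_sub_right {n : ℕ} {a b : Fin n → ℝ} (h : a ⬝ᵥ a = b ⬝ᵥ b) :
    reflect (a - b) b = a := by
  rw [← neg_sub b a, reflect_neg, reflect_sub_left h.symm]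

lemma reflect_add {n : ℕ} (u x y : Fin n → ℝ) : reflect u (x + y) = reflect u x + reflect u y := by
  simp only [reflect, dotProduct_add, mul_add, add_div, add_smul]
  abel

lemma dotProduct_reflect {n : ℕ} (u x y : Fin n → ℝ) :
    x ⬝ᵥ reflect u y = reflect u x ⬝ᵥ y := by
  simp only [reflect, sub_dotProduct, dotProduct_sub, dotProduct_smul, smul_dotProduct,
    smul_eq_mul, dotProduct_comm x u]
  ring

lemma ofLp_reflection_orthogonal_singleton {n : ℕ} (u x : EuclideanSpace ℝ (Fin n)) :
    ((ℝ ∙ u)ᗮ.reflection x).ofLp = reflect u.ofLp x.ofLp := by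
  have h1 : (inner ℝ u x : ℝ) = u.ofLp ⬝ᵥ x.ofLp := by
    rw [EuclideanSpace.inner_eq_star_dotProduct, dotProduct_comm, star_trivial]
  have h2 : (‖u‖ ^ 2 : ℝ) = u.ofLp ⬝ᵥ u.ofLp := by
    rw [← real_inner_self_eq_norm_sq, EuclideanSpace.inner_eq_star_dotProduct, star_trivial]
  rw [Submodule.reflection_orthogonal_apply, Submodule.reflection_singleton_apply, reflect, h1]
  simp only [RCLike.ofReal_real_eq_id, id_eq, h2]
  ext i
  simp
  ring

/-- The characteristic function depends on `t` only through its norm; this also covers variance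
zero. -/
lemma map_toLp_pi_gaussianReal_map_linearIsometryEquiv {n : ℕ} (v : ℝ≥0)
    (g : EuclideanSpace ℝ (Fin n) ≃ₗᵢ[ℝ] EuclideanSpace ℝ (Fin n)) :
    ((Measure.pi fun _ : Fin n => gaussianReal 0 v).map (WithLp.toLp 2)).map g =
      (Measure.pi fun _ : Fin n => gaussianReal 0 v).map (WithLp.toLp 2) := by
  have hmeas : Measurable (WithLp.toLp 2 : (Fin n → ℝ) → EuclideanSpace ℝ (Fin n)) := by fun_prop
  have : IsProbabilityMeasure ((Measure.pi fun _ : Fin n => gaussianReal 0 v).map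
      (WithLp.toLp 2 : (Fin n → ℝ) → EuclideanSpace ℝ (Fin n))) :=
    Measure.isProbabilityMeasure_map hmeas.aemeasurable
  have hchar (t : EuclideanSpace ℝ (Fin n)) :
      charFun ((Measure.pi fun _ : Fin n => gaussianReal 0 v).map
        (WithLp.toLp 2 : (Fin n → ℝ) → EuclideanSpace ℝ (Fin n))) t =
      Complex.exp (-(v * (‖t‖ ^ 2 : ℝ) / 2)) := by
    rw [charFun_pi]
    simp_rw [charFun_gaussianReal]
    rw [← Complex.exp_sum, EuclideanSpace.real_norm_sq_eq]
    congr 1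
    push_cast
    rw [Finset.mul_sum, Finset.sum_div, ← Finset.sum_neg_distrib]
    refine Finset.sum_congr rfl fun i _ => ?_
    simp
  have : IsProbabilityMeasure (((Measure.pi fun _ : Fin n => gaussianReal 0 v).map
      (WithLp.toLp 2 : (Fin n → ℝ) → EuclideanSpace ℝ (Fin n))).map g) :=
    Measure.isProbabilityMeasure_map (by fun_prop)
  refine Measure.ext_of_charFun ?_
  ext t
  have hg (x : EuclideanSpace ℝ (Fin n)) : inner ℝ (g x) t = inner ℝ x (g.symm t) := by
    rw [← g.symm.inner_map_map, g.symm_apply_apply]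
  rw [charFun_apply, integral_map (by fun_prop) (by fun_prop)]
  simp_rw [hg]
  rw [← charFun_apply, hchar, hchar, g.symm.norm_map]

lemma reflect_reflect {n : ℕ} (u x : Fin n → ℝ) : reflect u (reflect u x) = x := by
  have h := ofLp_reflection_orthogonal_singleton (WithLp.toLp 2 u)
    ((ℝ ∙ (WithLp.toLp 2 u))ᗮ.reflection (WithLp.toLp 2 x))
  rw [Submodule.reflection_reflection, ofLp_reflection_orthogonal_singleton] at h
  exact h.symm

lemma measurable_reflect {n : ℕ} (u : Fin n → ℝ) : Measurable (reflect u) := by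
  unfold reflect dotProduct
  fun_prop

/-- The reflection `reflect u` as a measurable equivalence. -/
noncomputable def reflectEquiv {n : ℕ} (u : Fin n → ℝ) : (Fin n → ℝ) ≃ᵐ (Fin n → ℝ) where
  toFun := reflect u
  invFun := reflect u
  left_inv := reflect_reflect u
  right_inv := reflect_reflect u
  measurable_toFun := measurable_reflect u
  measurable_invFun := measurable_reflect u

lemma measurePreserving_reflectEquiv {n : ℕ} (v : ℝ≥0) (u : Fin n → ℝ) :
    MeasurePreserving (reflectEquiv u) (Measure.pi fun _ : Fin n => gaussianReal 0 v)
      (Measure.pi fun _ : Fin n => gaussianReal 0 v) := by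
  refine ⟨(reflectEquiv u).measurable, ?_⟩
  have h := congrArg (Measure.map (WithLp.ofLp : EuclideanSpace ℝ (Fin n) → Fin n → ℝ))
    (map_toLp_pi_gaussianReal_map_linearIsometryEquiv v (ℝ ∙ (WithLp.toLp 2 u))ᗮ.reflection)
  rw [Measure.map_map (by fun_prop) (by fun_prop), Measure.map_map (by fun_prop) (by fun_prop),
    Measure.map_map (by fun_prop) (by fun_prop)] at h
  have h1 : (WithLp.ofLp : EuclideanSpace ℝ (Fin n) → Fin n → ℝ) ∘
      (ℝ ∙ (WithLp.toLp 2 u : EuclideanSpace ℝ (Fin n)))ᗮ.reflection ∘ WithLp.toLp 2 =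
      reflectEquiv u := by
    funext x
    exact ofLp_reflection_orthogonal_singleton _ _
  have h2 : (WithLp.ofLp : EuclideanSpace ℝ (Fin n) → Fin n → ℝ) ∘ WithLp.toLp 2 = id := rfl
  rw [← h1, Function.comp_assoc] at *
  rw [h, h2, Measure.map_id]

/-! ### The threshold -/

/-- The condition on `t` in the definition of the threshold. -/
def IsAdmissible {k : ℕ} (a : ℕ) (q : ℝ) (v : Fin k → ℝ) (t : ℝ) : Prop :=
  0 < t ∧
    ((a : ℝ) + ((Finset.univ.filter fun j => v j ≤ -t).card : ℝ)) /
      max ((Finset.univ.filter fun j => t ≤ v j).card : ℝ) 1 ≤ q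

section Threshold

variable {k : ℕ} {a : ℕ} {q : ℝ} {v : Fin k → ℝ}

lemma threshold_le_abs {l : Fin k} (h : IsAdmissible a q v |v l|) :
    threshold a q v ≤ (|v l| : ℝ) :=
  Finset.min_le (Finset.mem_filter.2 ⟨Finset.mem_image_of_mem _ (Finset.mem_univ l), h⟩)

lemma exists_threshold_eq_abs {x : ℝ} (h : threshold a q v ≤ (x : WithTop ℝ)) :
    ∃ l, threshold a q v = (|v l| : ℝ) ∧ IsAdmissible a q v |v l| := by
  obtain ⟨t, ht⟩ := WithTop.ne_top_iff_exists.1 (ne_top_of_le_ne_top WithTop.coe_ne_top h)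
  have hmem := Finset.mem_of_min ht.symm
  obtain ⟨him, hadm⟩ := Finset.mem_filter.1 hmem
  obtain ⟨l, -, rfl⟩ := Finset.mem_image.1 him
  exact ⟨l, ht.symm, hadm⟩

/-- A finite disjunction over indices replaces the minimum, which makes measurability of the
selection visible. -/
lemma threshold_le_iff {x : ℝ} :
    threshold a q v ≤ (x : WithTop ℝ) ↔ ∃ l, IsAdmissible a q v |v l| ∧ |v l| ≤ x := by
  constructor
  · intro h
    obtain ⟨l, hl, hadm⟩ := exists_threshold_eq_abs h
    exact ⟨l, hadm, WithTop.coe_le_coe.1 (hl ▸ h)⟩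
  · rintro ⟨l, hadm, hl⟩
    exact (threshold_le_abs hadm).trans (WithTop.coe_le_coe.2 hl)

end Threshold

lemma measurable_card_filter {α ι : Type*} [MeasurableSpace α] [Fintype ι] {p : α → ι → Prop}
    [∀ x, DecidablePred (p x)] (hp : ∀ i, MeasurableSet {x | p x i}) :
    Measurable fun x => ((Finset.univ.filter (p x)).card : ℝ) := by
  simp_rw [Finset.card_filter, Nat.cast_sum, Nat.cast_ite, Nat.cast_one, Nat.cast_zero]
  exact Finset.measurable_sum _ fun i _ =>
    Measurable.ite (hp i) measurable_const measurable_const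

lemma measurableSet_isAdmissible {k : ℕ} (a : ℕ) (q : ℝ) (l : Fin k) :
    MeasurableSet {v : Fin k → ℝ | IsAdmissible a q v |v l|} := by
  have habs : Measurable fun v : Fin k → ℝ => |v l| := (measurable_pi_apply l).abs
  have h1 : Measurable fun v : Fin k → ℝ =>
      ((Finset.univ.filter fun j => v j ≤ -|v l|).card : ℝ) :=
    measurable_card_filter fun j => measurableSet_le (measurable_pi_apply j) habs.neg
  have h2 : Measurable fun v : Fin k → ℝ =>
      ((Finset.univ.filter fun j => |v l| ≤ v j).card : ℝ) :=
    measurable_card_filter fun j => measurableSet_le habs (measurable_pi_apply j)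
  exact (measurableSet_lt measurable_const habs).inter
    (measurableSet_le ((h1.const_add _).div (h2.max measurable_const)) measurable_const)

lemma measurableSet_mem_selected {k : ℕ} (a : ℕ) (q : ℝ) (j : Fin k) :
    MeasurableSet {v : Fin k → ℝ | j ∈ selected a q v} := by
  have : {v : Fin k → ℝ | j ∈ selected a q v} =
      ⋃ l, {v : Fin k → ℝ | IsAdmissible a q v |v l|} ∩ {v | |v l| ≤ v j} := by
    ext v
    simp [selected, threshold_le_iff]
  rw [this]
  exact MeasurableSet.iUnion fun l => (measurableSet_isAdmissible a q l).inter
    (measurableSet_le (measurable_pi_apply l).abs (measurable_pi_apply j))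

lemma measurable_comp_selected {k : ℕ} (a : ℕ) (q : ℝ) (g : Finset (Fin k) → ℝ≥0∞) :
    Measurable fun v : Fin k → ℝ => g (selected a q v) := by
  let _ : MeasurableSpace (Finset (Fin k)) := ⊤
  have hg : Measurable g := measurable_from_top
  refine hg.comp (measurable_to_countable' fun S => ?_)
  have : selected a q ⁻¹' {S} = ⋂ j : Fin k,
      {v | j ∈ selected a q v ↔ j ∈ S} := by
    ext v
    simp [Finset.ext_iff]
  rw [this]
  refine MeasurableSet.iInter fun j => ?_
  by_cases hj : j ∈ S
  · simpa [hj] using measurableSet_mem_selected a q j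
  · simp only [hj, iff_false]
    exact (measurableSet_mem_selected a q j).compl

/-! ### Sign flips of a single statistic -/

/-- Change the sign of the entry `j`. -/
def flipSign {k : ℕ} (j : Fin k) (v : Fin k → ℝ) : Fin k → ℝ :=
  Function.update v j (-v j)

/-- Replace the entry `j` by its absolute value. -/
def makeNonneg {k : ℕ} (j : Fin k) (v : Fin k → ℝ) : Fin k → ℝ :=
  Function.update v j |v j|

section SignFlips

variable {k : ℕ} {a : ℕ} {q : ℝ} {v : Fin k → ℝ} {j l : Fin k}

lemma makeNonneg_flipSign (j : Fin k) (v : Fin k → ℝ) :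
    makeNonneg j (flipSign j v) = makeNonneg j v := by
  simp [makeNonneg, flipSign]

lemma makeNonneg_of_nonneg (h : 0 ≤ v j) : makeNonneg j v = v := by
  rw [makeNonneg, abs_of_nonneg h, Function.update_eq_self]

lemma abs_makeNonneg (j : Fin k) (v : Fin k → ℝ) (i : Fin k) : |makeNonneg j v i| = |v i| := by
  rcases eq_or_ne i j with rfl | h
  · simp [makeNonneg]
  · simp [makeNonneg, h]

lemma filter_makeNonneg_le_neg {t : ℝ} (ht : 0 < t) :
    (Finset.univ.filter fun i => makeNonneg j v i ≤ -t) =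
      (Finset.univ.filter fun i => v i ≤ -t).erase j := by
  ext i
  simp only [Finset.mem_erase, Finset.mem_filter_univ]
  rcases eq_or_ne i j with rfl | h
  · simpa [makeNonneg] using lt_of_lt_of_le (neg_lt_zero.2 ht) (abs_nonneg (v i))
  · simp [makeNonneg, h]

lemma filter_le_makeNonneg {t : ℝ} (hj : t ≤ |v j|) :
    (Finset.univ.filter fun i => t ≤ makeNonneg j v i) =
      insert j (Finset.univ.filter fun i => t ≤ v i) := by
  ext i
  simp only [Finset.mem_insert, Finset.mem_filter_univ]
  rcases eq_or_ne i j with rfl | h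
  · simpa [makeNonneg] using hj
  · simp [makeNonneg, h]

/-- Either modification moves exactly one index from the negative count to the positive count, so
the two ratios coincide. -/
lemma isAdmissible_makeNonneg {t : ℝ} (hj : v j < 0) (hl : v l < 0) (htj : t ≤ |v j|)
    (htl : t ≤ |v l|) (h : IsAdmissible a q (makeNonneg j v) t) :
    IsAdmissible a q (makeNonneg l v) t := by
  obtain ⟨ht, h⟩ := h
  refine ⟨ht, ?_⟩
  rw [abs_of_neg hj] at htj
  rw [abs_of_neg hl] at htl
  have mem (i : Fin k) (h : t ≤ -v i) : i ∈ Finset.univ.filter fun i => v i ≤ -t :=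
    Finset.mem_filter.2 ⟨Finset.mem_univ i, by linarith⟩
  have not_mem (i : Fin k) (h : v i < 0) : i ∉ Finset.univ.filter fun i => t ≤ v i := by
    simpa using h.trans ht
  rw [filter_makeNonneg_le_neg ht, filter_le_makeNonneg (by rwa [abs_of_neg hj]),
    Finset.card_erase_of_mem (mem j htj), Finset.card_insert_of_notMem (not_mem j hj)] at h
  rwa [filter_makeNonneg_le_neg ht, filter_le_makeNonneg (by rwa [abs_of_neg hl]),
    Finset.card_erase_of_mem (mem l htl), Finset.card_insert_of_notMem (not_mem l hl)]

/-- The smaller threshold is at most both `|v j|` and `|v l|`, so its admissibility carries over to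
the other modification. -/
lemma threshold_makeNonneg_le (hj : v j < 0) (hl : v l < 0)
    (hTj : threshold a q (makeNonneg j v) ≤ (|v j| : ℝ))
    (hTl : threshold a q (makeNonneg l v) ≤ (|v l| : ℝ))
    (h : threshold a q (makeNonneg j v) ≤ threshold a q (makeNonneg l v)) :
    threshold a q (makeNonneg l v) ≤ threshold a q (makeNonneg j v) := by
  obtain ⟨i, hi, hadm⟩ := exists_threshold_eq_abs hTj
  have hil := h.trans hTl
  rw [hi, abs_makeNonneg] at hTj hil
  rw [abs_makeNonneg] at hadm
  have := isAdmissible_makeNonneg hj hl (WithTop.coe_le_coe.1 hTj) (WithTop.coe_le_coe.1 hil) hadm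
  rw [hi, abs_makeNonneg, ← abs_makeNonneg l]
  exact threshold_le_abs (by rwa [abs_makeNonneg])

lemma threshold_makeNonneg_eq (hj : v j < 0) (hl : v l < 0)
    (hTj : threshold a q (makeNonneg j v) ≤ (|v j| : ℝ))
    (hTl : threshold a q (makeNonneg l v) ≤ (|v l| : ℝ)) :
    threshold a q (makeNonneg j v) = threshold a q (makeNonneg l v) := by
  rcases le_total (threshold a q (makeNonneg j v)) (threshold a q (makeNonneg l v)) with h | h
  · exact le_antisymm h (threshold_makeNonneg_le hj hl hTj hTl h)
  · exact le_antisymm (threshold_makeNonneg_le hl hj hTl hTj h) h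

end SignFlips

/-! ### The leave-one-out estimate -/

/-- Superadditivity of the lower integral avoids proving that `posPart` is measurable. -/
lemma sum_lintegral_le_lintegral_sum {α ι : Type*} [MeasurableSpace α] (ν : Measure α)
    (s : Finset ι) (f : ι → α → ℝ≥0∞) :
    ∑ i ∈ s, ∫⁻ x, f i x ∂ν ≤ ∫⁻ x, ∑ i ∈ s, f i x ∂ν := by
  classical
  induction s using Finset.induction_on with
  | empty => simp
  | insert i s hi ih =>
    simp_rw [Finset.sum_insert hi]
    exact (add_le_add_right ih _).trans (le_lintegral_add _ _)

/-- The reciprocal of `1 + #{l ∈ H₀ \ {j} : W_l ≤ -T_j}`, where `T_j` is the threshold computed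
from `|W_j|` instead of `W_j`. -/
noncomputable def looWeight {k : ℕ} (a : ℕ) (q : ℝ) (H₀ : Finset (Fin k)) (j : Fin k)
    (v : Fin k → ℝ) : ℝ≥0∞ :=
  ((1 + ((H₀.erase j).filter fun l =>
    threshold a q (makeNonneg j v) ≤ ((-v l : ℝ) : WithTop ℝ)).card : ℕ) : ℝ≥0∞)⁻¹

/-- The contribution of the index `j` to `V⁺ / (1 + V⁻)`. -/
noncomputable def posPart {k : ℕ} (a : ℕ) (q : ℝ) (H₀ : Finset (Fin k)) (j : Fin k)
    (v : Fin k → ℝ) : ℝ≥0∞ :=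
  open Classical in
  if 0 < v j ∧ threshold a q (makeNonneg j v) ≤ (|v j| : ℝ) then looWeight a q H₀ j v else 0

section LeaveOneOut

variable {k : ℕ} {a : ℕ} {q : ℝ} {H₀ : Finset (Fin k)}

/-- The threshold sees only `|v j|`, and `j` itself is erased from the count. -/
lemma looWeight_flipSign (j : Fin k) (v : Fin k → ℝ) :
    looWeight a q H₀ j (flipSign j v) = looWeight a q H₀ j v := by
  unfold looWeight
  rw [makeNonneg_flipSign]
  congr 4
  refine Finset.filter_congr fun l hl => ?_
  rw [flipSign, Function.update_of_ne (Finset.ne_of_mem_erase hl)]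

/-- The contributing indices form the set `J` below. Their thresholds agree, so the count in the
weight of `j` contains the rest of `J`, and each weight is at most `1 / #J`. -/
lemma sum_posPart_flipSign_le_one (v : Fin k → ℝ) :
    ∑ j ∈ H₀, posPart a q H₀ j (flipSign j v) ≤ 1 := by
  classical
  have hterm (j : Fin k) : posPart a q H₀ j (flipSign j v) =
      if v j < 0 ∧ threshold a q (makeNonneg j v) ≤ (|v j| : ℝ) then looWeight a q H₀ j v
        else 0 := by
    rw [posPart, looWeight_flipSign, makeNonneg_flipSign]
    simp [flipSign]
  simp_rw [hterm]
  rw [← Finset.sum_filter]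
  set J := H₀.filter fun j => v j < 0 ∧ threshold a q (makeNonneg j v) ≤ (|v j| : ℝ) with hJ
  have hle (j) (hj : j ∈ J) : looWeight a q H₀ j v ≤ (J.card : ℝ≥0∞)⁻¹ := by
    refine ENNReal.inv_le_inv.2 (Nat.cast_le.2 ?_)
    have hsub : J.erase j ⊆ (H₀.erase j).filter fun l =>
        threshold a q (makeNonneg j v) ≤ ((-v l : ℝ) : WithTop ℝ) := by
      intro l hl
      obtain ⟨hlj, hl⟩ := Finset.mem_erase.1 hl
      obtain ⟨-, hj0, hj1⟩ := Finset.mem_filter.1 hj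
      obtain ⟨hlH, hl0, hl1⟩ := Finset.mem_filter.1 hl
      refine Finset.mem_filter.2 ⟨Finset.mem_erase.2 ⟨hlj, hlH⟩, ?_⟩
      rw [threshold_makeNonneg_eq hj0 hl0 hj1 hl1, ← abs_of_neg hl0]
      exact hl1
    have := Finset.card_le_card hsub
    have := Finset.card_erase_add_one hj
    omega
  refine (Finset.sum_le_sum hle).trans ?_
  rw [Finset.sum_const, nsmul_eq_mul]
  -- For empty `J` this reads `0 * ∞ = 0`.
  exact ENNReal.mul_inv_le_one _

/-- A selected entry is positive, so its leave-one-out threshold is the actual one; the weight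
counts only nulls other than `j`, hence no more than all indices below `-t`. -/
lemma inv_le_mul_posPart {v : Fin k → ℝ} {j : Fin k} {b : ℝ≥0∞} (hj : j ∈ selected a q v)
    (hb : ∀ t, IsAdmissible a q v t → (selected a q v) = (Finset.univ.filter fun l => t ≤ v l) →
      b⁻¹ ≤ ENNReal.ofReal q *
        ((1 + (Finset.univ.filter fun l => v l ≤ -t).card : ℕ) : ℝ≥0∞)⁻¹) :
    b⁻¹ ≤ ENNReal.ofReal q * posPart a q H₀ j v := by
  have hj := (Finset.mem_filter.1 hj).2
  obtain ⟨i, hi, hadm⟩ := exists_threshold_eq_abs hj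
  have hpos : 0 < v j := hadm.1.trans_le (WithTop.coe_le_coe.1 (hi ▸ hj))
  have hT : makeNonneg j v = v := makeNonneg_of_nonneg hpos.le
  refine (hb _ hadm (by simp only [selected, hi, WithTop.coe_le_coe])).trans ?_
  rw [posPart, hT, if_pos ⟨hpos, by rwa [abs_of_pos hpos]⟩, looWeight, hT]
  gcongr
  intro l hl
  have := (Finset.mem_filter.1 hl).2
  rw [hi, WithTop.coe_le_coe] at this
  exact Finset.mem_filter.2 ⟨Finset.mem_univ l, by linarith⟩

/-- The leave-one-out argument: if the law of the statistics is invariant under the sign flip of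
every null entry, then a false discovery rate with the denominator `b` is at most `q`. -/
theorem lintegral_card_selected_inter_div_le {α : Type*} [MeasurableSpace α] (ν : Measure α)
    [IsProbabilityMeasure ν] {W : α → Fin k → ℝ} (hW : Measurable W)
    (hflip : ∀ j ∈ H₀, ∃ e : α ≃ᵐ α, MeasurePreserving e ν ν ∧
      ∀ x, W (e x) = flipSign j (W x))
    (b : Finset (Fin k) → ℝ≥0∞)
    (hb : ∀ (v : Fin k → ℝ) (t : ℝ), IsAdmissible a q v t → (selected a q v).Nonempty →
      (selected a q v) = (Finset.univ.filter fun l => t ≤ v l) →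
      (b (selected a q v))⁻¹ ≤ ENNReal.ofReal q *
        ((1 + (Finset.univ.filter fun l => v l ≤ -t).card : ℕ) : ℝ≥0∞)⁻¹) :
    ∫⁻ x, ((selected a q (W x) ∩ H₀).card : ℝ≥0∞) / b (selected a q (W x)) ∂ν ≤
      ENNReal.ofReal q := by
  have hsum (S : Finset (Fin k)) : ((S ∩ H₀).card : ℝ≥0∞) / b S =
      ∑ j ∈ H₀, if j ∈ S then (b S)⁻¹ else 0 := by
    rw [← Finset.sum_filter, Finset.filter_mem_eq_inter, Finset.sum_const, nsmul_eq_mul,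
      div_eq_mul_inv, Finset.inter_comm]
  simp_rw [hsum]
  have hmeas (j : Fin k) : Measurable fun x =>
      if j ∈ selected a q (W x) then (b (selected a q (W x)))⁻¹ else 0 :=
    (measurable_comp_selected a q fun S => if j ∈ S then (b S)⁻¹ else 0).comp hW
  rw [lintegral_finsetSum _ fun j _ => hmeas j]
  calc ∑ j ∈ H₀, ∫⁻ x, (if j ∈ selected a q (W x) then (b (selected a q (W x)))⁻¹ else 0) ∂ν
      ≤ ∑ j ∈ H₀, ENNReal.ofReal q * ∫⁻ x, posPart a q H₀ j (flipSign j (W x)) ∂ν := by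
        refine Finset.sum_le_sum fun j hj => ?_
        obtain ⟨e, he, heW⟩ := hflip j hj
        -- The change of variables by `e` undoes the flip inside the integral.
        simp_rw [← heW]
        rw [he.lintegral_comp_emb e.measurableEmbedding fun x => posPart a q H₀ j (W x),
          ← lintegral_const_mul' _ _ ENNReal.ofReal_ne_top]
        refine lintegral_mono fun x => ?_
        dsimp only
        split_ifs with hmem
        · exact inv_le_mul_posPart hmem fun t ht hS => hb _ t ht ⟨j, hmem⟩ hS
        · exact zero_le
    _ ≤ ENNReal.ofReal q * ∫⁻ x, ∑ j ∈ H₀, posPart a q H₀ j (flipSign j (W x)) ∂ν := by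
        rw [← Finset.mul_sum]
        gcongr
        exact sum_lintegral_le_lintegral_sum _ _ _
    _ ≤ ENNReal.ofReal q * ∫⁻ _, 1 ∂ν := by
        gcongr
        exact sum_posPart_flipSign_le_one _
    _ = ENNReal.ofReal q := by simp

end LeaveOneOut

/-! ### The error rates -/

lemma inv_le_mul_inv_of_le_mul {x b r : ℝ≥0∞} (hx0 : x ≠ 0) (hx : x ≠ ∞) (hb0 : b ≠ 0)
    (hb : b ≠ ∞) (h : x ≤ r * b) : b⁻¹ ≤ r * x⁻¹ := by
  rw [← div_eq_mul_inv, ENNReal.le_div_iff_mul_le (Or.inl hx0) (Or.inl hx)]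
  calc b⁻¹ * x ≤ b⁻¹ * (r * b) := by gcongr
    _ = r * (b⁻¹ * b) := by ring
    _ = r := by rw [ENNReal.inv_mul_cancel hb0 hb, mul_one]

lemma natCast_le_ofReal_mul_natCast {q : ℝ} (hq : 0 ≤ q) {x r : ℕ} (h : (x : ℝ) ≤ q * r) :
    (x : ℝ≥0∞) ≤ ENNReal.ofReal q * r := by
  rw [← ENNReal.ofReal_natCast x, ← ENNReal.ofReal_natCast r, ← ENNReal.ofReal_mul hq]
  exact ENNReal.ofReal_le_ofReal h

section ErrorRates

variable {k : ℕ} {a : ℕ} {q : ℝ} {α : Type*} [MeasurableSpace α] {ν : Measure α}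
  [IsProbabilityMeasure ν] {W : α → Fin k → ℝ} {H₀ : Finset (Fin k)}

lemma IsAdmissible.add_card_le {v : Fin k → ℝ} {t : ℝ} (h : IsAdmissible a q v t)
    (hne : (Finset.univ.filter fun l => t ≤ v l).Nonempty) :
    ((a + (Finset.univ.filter fun l => v l ≤ -t).card : ℕ) : ℝ) ≤
      q * ((Finset.univ.filter fun l => t ≤ v l).card : ℕ) := by
  have hcard : (1 : ℝ) ≤ ((Finset.univ.filter fun l => t ≤ v l).card : ℝ) := by
    exact_mod_cast hne.card_pos
  have := h.2
  rw [max_eq_left hcard, div_le_iff₀ (by linarith)] at this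
  exact_mod_cast this

theorem groupFDR_selected_one_le (hq : 0 ≤ q) (hW : Measurable W)
    (hflip : ∀ j ∈ H₀, ∃ e : α ≃ᵐ α, MeasurePreserving e ν ν ∧
      ∀ x, W (e x) = flipSign j (W x)) :
    groupFDR ν H₀ (fun x => selected 1 q (W x)) ≤ ENNReal.ofReal q := by
  refine lintegral_card_selected_inter_div_le ν hW hflip (fun S => max (S.card : ℝ≥0∞) 1) ?_
  intro v t hadm hne hS
  have hcard : (1 : ℝ≥0∞) ≤ (selected 1 q v).card := by exact_mod_cast hne.card_pos
  simp only [max_eq_left hcard]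
  refine inv_le_mul_inv_of_le_mul (by simp) (ENNReal.natCast_ne_top _)
    (zero_lt_one.trans_le hcard).ne' (ENNReal.natCast_ne_top _) ?_
  rw [hS] at hne ⊢
  exact natCast_le_ofReal_mul_natCast hq (hadm.add_card_le hne)

theorem groupMFDR_selected_zero_le (hq : 0 ≤ q) (hW : Measurable W)
    (hflip : ∀ j ∈ H₀, ∃ e : α ≃ᵐ α, MeasurePreserving e ν ν ∧
      ∀ x, W (e x) = flipSign j (W x)) :
    groupMFDR ν H₀ q (fun x => selected 0 q (W x)) ≤ ENNReal.ofReal q := by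
  refine lintegral_card_selected_inter_div_le ν hW hflip
    (fun S => (S.card : ℝ≥0∞) + (ENNReal.ofReal q)⁻¹) ?_
  intro v t hadm hne hS
  rcases hq.eq_or_lt with rfl | hq'
  -- For `q = 0` the denominator is `∞` and its inverse vanishes.
  · simp
  have hq0 : ENNReal.ofReal q ≠ 0 := by simpa using hq'
  refine inv_le_mul_inv_of_le_mul (by simp) (ENNReal.natCast_ne_top _) (by simp)
    (ENNReal.add_ne_top.2 ⟨ENNReal.natCast_ne_top _, ENNReal.inv_ne_top.2 hq0⟩) ?_
  -- The summand `q⁻¹` of the denominator, multiplied by `q`, supplies the `1` that the offset `a =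
  -- 0` lacks.
  rw [mul_add, ENNReal.mul_inv_cancel hq0 ENNReal.ofReal_ne_top, Nat.cast_add, add_comm,
    Nat.cast_one]
  gcongr
  rw [hS] at hne ⊢
  have := natCast_le_ofReal_mul_natCast hq (hadm.add_card_le hne)
  rwa [zero_add] at this

end ErrorRates

lemma lintegral_comp_selected_hasLaw {Ω α : Type*} [MeasurableSpace Ω]
    [MeasurableSpace α] {k a : ℕ} {q : ℝ} {P : Measure Ω} {ν : Measure α} {X : Ω → α}
    {W : α → Fin k → ℝ} (hX : HasLaw X ν P) (hW : Measurable W) (g : Finset (Fin k) → ℝ≥0∞) :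
    ∫⁻ ω, g (selected a q (W (X ω))) ∂P = ∫⁻ x, g (selected a q (W x)) ∂ν :=
  hX.lintegral_comp ((measurable_comp_selected a q g).comp hW).aemeasurable

/-! ### Reflections that interchange a feature with its knockoff -/

section Swap

variable {n k m : ℕ}

lemma transpose_swapCols_apply (S : Finset (Fin k)) (Z : Matrix (Fin n) (Fin k ⊕ Fin k) ℝ)
    (c : Fin k ⊕ Fin k) :
    (swapCols S Z)ᵀ c = if c.elim id id ∈ S then Zᵀ c.swap else Zᵀ c := by
  ext r
  simp only [Matrix.transpose_apply, swapCols]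
  split_ifs <;> rfl

lemma IsOrthogonalFrame.swapCols {Z : Matrix (Fin n) (Fin k ⊕ Fin k) ℝ}
    {N : Matrix (Fin n) (Fin m) ℝ} (h : IsOrthogonalFrame Z N) (S : Finset (Fin k)) :
    IsOrthogonalFrame (swapCols S Z) N := by
  refine ⟨h.orthonormal, ?_⟩
  ext i c
  have key (d : Fin k ⊕ Fin k) : Nᵀ i ⬝ᵥ Zᵀ d = 0 := congrFun (congrFun h.orthogonal i) d
  change Nᵀ i ⬝ᵥ (PCAKnockoff.swapCols S Z)ᵀ c = 0
  rw [transpose_swapCols_apply]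
  split_ifs <;> exact key _

/-- A reflection is self-adjoint and isometric: reflecting `y` has the same effect on the products
as swapping columns of `Z`, and the swap keeps the Gram matrix. Sufficiency then reduces the claim
to antisymmetry. -/
lemma IsKnockoffStatistic.apply_reflect
    {w : Matrix (Fin n) (Fin k ⊕ Fin k) ℝ → Matrix (Fin n) (Fin m) ℝ → (Fin n → ℝ) → (Fin k → ℝ)}
    (hw : IsKnockoffStatistic w) {Z : Matrix (Fin n) (Fin k ⊕ Fin k) ℝ}
    {N : Matrix (Fin n) (Fin m) ℝ} (hN : IsOrthogonalFrame Z N) {u : Fin n → ℝ} {j : Fin k}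
    (hZ : ∀ c, reflect u (Zᵀ c) = (swapCols {j} Z)ᵀ c) (hNu : ∀ i, reflect u (Nᵀ i) = Nᵀ i)
    (y : Fin n → ℝ) : w Z N (reflect u y) = flipSign j (w Z N y) := by
  have hgram : (swapCols {j} Z)ᵀ * swapCols {j} Z = Zᵀ * Z := by
    ext c d
    change (swapCols {j} Z)ᵀ c ⬝ᵥ (swapCols {j} Z)ᵀ d = Zᵀ c ⬝ᵥ Zᵀ d
    rw [← hZ, ← hZ, ← dotProduct_reflect, reflect_reflect]
  have hZy : (swapCols {j} Z)ᵀ *ᵥ y = Zᵀ *ᵥ reflect u y := by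
    ext c
    change (swapCols {j} Z)ᵀ c ⬝ᵥ y = Zᵀ c ⬝ᵥ reflect u y
    rw [← hZ, dotProduct_reflect]
  have hNy : Nᵀ *ᵥ y = Nᵀ *ᵥ reflect u y := by
    ext i
    change Nᵀ i ⬝ᵥ y = Nᵀ i ⬝ᵥ reflect u y
    rw [dotProduct_reflect, hNu]
  obtain ⟨f, hf⟩ := hw.sufficiency
  rw [hf Z N hN, ← hgram, ← hZy, ← hNy, ← hf _ N (hN.swapCols {j})]
  ext l
  rw [hw.antisymmetry Z N hN]
  rcases eq_or_ne l j with rfl | h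
  · simp [flipSign]
  · simp [flipSign, h]

end Swap

/-! ### Localized knockoffs of prototypes -/

section Localized

variable {n k m : ℕ} {c : Fin k → ℕ} [∀ i, NeZero (c i)]
  {U : (i : Fin k) → Matrix (Fin n) (Fin (c i)) ℝ} {UtP : Matrix (Fin n) (Fin k) ℝ}
  {s : Fin k → ℝ}

lemma IsLocalizedKnockoff.dotProduct_knockoff (h : IsLocalizedKnockoff U UtP s) (i j : Fin k) :
    UtPᵀ i ⬝ᵥ UtPᵀ j = (prototypes U)ᵀ i ⬝ᵥ (prototypes U)ᵀ j := by
  have := congrFun (congrFun h.gram ⟨i, 0⟩) ⟨j, 0⟩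
  simpa [Matrix.mul_apply, replacePrototypes, joinBlocks, dotProduct, prototypes] using this

/-- These are off-diagonal entries of the cross identity. The case `a ≠ 0` is where keeping `U_Q` in
the knockoff construction matters. -/
lemma IsLocalizedKnockoff.sub_dotProduct_of_ne (h : IsLocalizedKnockoff U UtP s) {i j : Fin k}
    (hij : i ≠ j) (a : Fin (c i)) :
    ((prototypes U)ᵀ j - UtPᵀ j) ⬝ᵥ (U i)ᵀ a = 0 := by
  have := congrFun (congrFun h.cross ⟨j, 0⟩) ⟨i, a⟩
  rw [Matrix.diagonal_apply_ne _ (by simp [hij.symm])] at this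
  rw [sub_dotProduct]
  simpa [Matrix.mul_apply, replacePrototypes, joinBlocks, dotProduct, prototypes] using this

lemma IsLocalizedKnockoff.sub_dotProduct_knockoff_of_ne (h : IsLocalizedKnockoff U UtP s)
    {i j : Fin k} (hij : i ≠ j) :
    ((prototypes U)ᵀ j - UtPᵀ j) ⬝ᵥ UtPᵀ i = 0 := by
  have h1 := h.sub_dotProduct_of_ne hij.symm 0
  change ((prototypes U)ᵀ i - UtPᵀ i) ⬝ᵥ (prototypes U)ᵀ j = 0 at h1
  rw [sub_dotProduct] at h1 ⊢
  rw [h.dotProduct_knockoff, dotProduct_comm, dotProduct_comm ((prototypes U)ᵀ j)]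
  linarith

lemma IsLocalizedKnockoff.reflect_column (h : IsLocalizedKnockoff U UtP s) (j : Fin k)
    (d : Fin k ⊕ Fin k) :
    reflect ((prototypes U)ᵀ j - UtPᵀ j) ((Matrix.fromCols (prototypes U) UtP)ᵀ d) =
      (swapCols {j} (Matrix.fromCols (prototypes U) UtP))ᵀ d := by
  rw [transpose_swapCols_apply]
  rcases d with i | i
  · rcases eq_or_ne i j with rfl | hij
    · rw [if_pos (by simp)]
      exact reflect_sub_left (h.dotProduct_knockoff i i).symm
    · rw [if_neg (by simpa using hij)]
      exact reflect_of_dotProduct_eq_zero (h.sub_dotProduct_of_ne hij 0)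
  · rcases eq_or_ne i j with rfl | hij
    · rw [if_pos (by simp)]
      exact reflect_sub_right (h.dotProduct_knockoff i i).symm
    · rw [if_neg (by simpa using hij)]
      exact reflect_of_dotProduct_eq_zero (h.sub_dotProduct_knockoff_of_ne hij)

lemma IsOrthogonalFrame.sub_dotProduct_eq_zero {A B : Matrix (Fin n) (Fin k) ℝ}
    {N : Matrix (Fin n) (Fin m) ℝ} (hN : IsOrthogonalFrame (Matrix.fromCols A B) N) (j : Fin k)
    (i : Fin m) : (Aᵀ j - Bᵀ j) ⬝ᵥ Nᵀ i = 0 := by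
  have key (d : Fin k ⊕ Fin k) : Nᵀ i ⬝ᵥ (Matrix.fromCols A B)ᵀ d = 0 :=
    congrFun (congrFun hN.orthogonal i) d
  have h1 : Nᵀ i ⬝ᵥ Aᵀ j = 0 := key (Sum.inl j)
  have h2 : Nᵀ i ⬝ᵥ Bᵀ j = 0 := key (Sum.inr j)
  rw [dotProduct_comm, dotProduct_sub, h1, h2, sub_zero]

/-- Group `j` drops out because its coefficients vanish; for the others, the decomposition puts the
columns of `X` in the span of those of `U i`. -/
lemma IsLocalizedKnockoff.sub_dotProduct_mulVec_eq_zero (h : IsLocalizedKnockoff U UtP s)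
    {X : Matrix (Fin n) ((i : Fin k) × Fin (c i)) ℝ} {d : (i : Fin k) → Fin (c i) → ℝ}
    {V : (i : Fin k) → Matrix (Fin (c i)) (Fin (c i)) ℝ}
    (hsvd : ∀ i, IsSVD (groupBlock X i) (U i) (d i) (V i))
    {β : (i : Fin k) × Fin (c i) → ℝ} {j : Fin k} (hj : j ∈ nullGroups β) :
    ((prototypes U)ᵀ j - UtPᵀ j) ⬝ᵥ (X *ᵥ β) = 0 := by
  rw [Matrix.dotProduct_mulVec]
  refine Finset.sum_eq_zero fun ⟨i, a⟩ _ => ?_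
  rcases eq_or_ne i j with rfl | hij
  · rw [(Finset.mem_filter.1 hj).2 a, mul_zero]
  · have hU : ((prototypes U)ᵀ j - UtPᵀ j) ᵥ* U i = 0 := by
      ext b
      exact h.sub_dotProduct_of_ne hij b
    have hX : ((prototypes U)ᵀ j - UtPᵀ j) ᵥ* groupBlock X i = 0 := by
      rw [(hsvd i).decomposition, Matrix.mul_assoc, ← Matrix.vecMul_vecMul, hU,
        Matrix.zero_vecMul]
    have hXa : (((prototypes U)ᵀ j - UtPᵀ j) ᵥ* X) ⟨i, a⟩ = 0 := congrFun hX a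
    rw [hXa, zero_mul]

end Localized

end PCAKnockoff

/-! ### Control of both error rates -/

theorem theorem1 {Ω : Type*} [MeasurableSpace Ω] (P : Measure Ω) [IsProbabilityMeasure P]
    {n k m : ℕ} {c : Fin k → ℕ} [∀ i, NeZero (c i)]
    -- the linear model `y = X β + ε` with Gaussian noise
    (X : Matrix (Fin n) ((i : Fin k) × Fin (c i)) ℝ) (β : (i : Fin k) × Fin (c i) → ℝ)
    (σ : ℝ≥0) (ε : Ω → Fin n → ℝ)
    (hε : HasLaw ε (Measure.pi fun _ : Fin n => gaussianReal 0 (σ ^ 2)) P)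
    -- the singular value decomposition of every group
    (U : (i : Fin k) → Matrix (Fin n) (Fin (c i)) ℝ) (d : (i : Fin k) → Fin (c i) → ℝ)
    (V : (i : Fin k) → Matrix (Fin (c i)) (Fin (c i)) ℝ)
    (hsvd : ∀ i, PCAKnockoff.IsSVD (PCAKnockoff.groupBlock X i) (U i) (d i) (V i))
    -- localized knockoffs of the first principal components
    (UtP : Matrix (Fin n) (Fin k) ℝ) (s : Fin k → ℝ)
    (hknock : PCAKnockoff.IsLocalizedKnockoff U UtP s)
    -- a knockoff statistic of `[U_P, Ũ_P]` and `y`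
    (N : Matrix (Fin n) (Fin m) ℝ)
    (hN : PCAKnockoff.IsOrthogonalFrame
      (Matrix.fromCols (PCAKnockoff.prototypes U) UtP) N)
    (w : Matrix (Fin n) (Fin k ⊕ Fin k) ℝ → Matrix (Fin n) (Fin m) ℝ → (Fin n → ℝ) →
      (Fin k → ℝ))
    (hw : PCAKnockoff.IsKnockoffStatistic w)
    (q : ℝ) (hq : q ∈ Set.Icc (0 : ℝ) 1) :
    PCAKnockoff.groupMFDR P (PCAKnockoff.nullGroups β) q
        (fun ω => PCAKnockoff.selected 0 q
          (w (Matrix.fromCols (PCAKnockoff.prototypes U) UtP) N (X *ᵥ β + ε ω)))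
        ≤ ENNReal.ofReal q ∧
      PCAKnockoff.groupFDR P (PCAKnockoff.nullGroups β)
        (fun ω => PCAKnockoff.selected 1 q
          (w (Matrix.fromCols (PCAKnockoff.prototypes U) UtP) N (X *ᵥ β + ε ω)))
        ≤ ENNReal.ofReal q := by
  set Z := Matrix.fromCols (PCAKnockoff.prototypes U) UtP
  set W : (Fin n → ℝ) → Fin k → ℝ := fun x => w Z N (X *ᵥ β + x)
  have hWmeas : Measurable W := (hw.measurable Z N hN).comp (measurable_const.add measurable_id)
  have hflip (j : Fin k) (hj : j ∈ PCAKnockoff.nullGroups β) :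
      ∃ e : (Fin n → ℝ) ≃ᵐ (Fin n → ℝ),
        MeasurePreserving e (Measure.pi fun _ : Fin n => gaussianReal 0 (σ ^ 2))
          (Measure.pi fun _ : Fin n => gaussianReal 0 (σ ^ 2)) ∧
        ∀ x, W (e x) = PCAKnockoff.flipSign j (W x) := by
    refine ⟨_, PCAKnockoff.measurePreserving_reflectEquiv (σ ^ 2)
      ((PCAKnockoff.prototypes U)ᵀ j - UtPᵀ j), fun x => ?_⟩
    have hmean := PCAKnockoff.reflect_of_dotProduct_eq_zero
      (hknock.sub_dotProduct_mulVec_eq_zero hsvd hj)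
    have := hw.apply_reflect hN (hknock.reflect_column j)
      (fun i => PCAKnockoff.reflect_of_dotProduct_eq_zero (hN.sub_dotProduct_eq_zero j i))
      (X *ᵥ β + x)
    rwa [PCAKnockoff.reflect_add, hmean] at this
  constructor
  · exact (PCAKnockoff.lintegral_comp_selected_hasLaw hε hWmeas fun S =>
      ((S ∩ PCAKnockoff.nullGroups β).card : ℝ≥0∞) /
        ((S.card : ℝ≥0∞) + (ENNReal.ofReal q)⁻¹)).trans_le
      (PCAKnockoff.groupMFDR_selected_zero_le hq.1 hWmeas hflip)
  · exact (PCAKnockoff.lintegral_comp_selected_hasLaw hε hWmeas fun S =>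
      ((S ∩ PCAKnockoff.nullGroups β).card : ℝ≥0∞) / max (S.card : ℝ≥0∞) 1).trans_le
      (PCAKnockoff.groupFDR_selected_one_le hq.1 hWmeas hflip)
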